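/- Let $m\ge 1$, let $W_1\neq 0$ and $W_2$ be positive semi-definite Hermitian complex $m\times m$ matrices ($W_k=H_k^+H_k$ for the channel matrices $H_k$, $m$ being the number of transmit antennas), and let $P_T>0$, $P_I\ge 0$ be the total and interference power limits in the problem $$\max_R\ \log|I+W_1R|\quad\text{s.t.}\quad R\ge 0,\ \operatorname{tr}R\le P_T,\ \operatorname{tr}(W_2R)\le P_I .$$ For $\mu_1,\mu_2\ge 0$ let $W_\mu=(\mu_1I+\mu_2W_2)^{1/2}$ and $$R^*(\mu_1,\mu_2)=W_\mu^\dagger\,(I-W_\mu W_1^{-1}W_\mu)_+\,W_\mu^\dagger ,$$ where $\dagger$ is the Moore–Penrose pseudo-inverse and $(\cdot)_+$ keeps the strictly positive eigenmodes of a Hermitian matrix. If $W_1$ is singular, $W_1^{-1}$ is read as infinite off the range of $W_1$, and only modes on which $W_\mu W_1^{-1}W_\mu$ is finite are kept: with $D$ the orthogonal projection onto $\{x: W_\mu x\in\operatorname{range}W_1\}$, the middle factor is $\bigl(D(I-W_\mu W_1^\dagger W_\mu)D\bigr)_+$. Let $\mu_1^*,\mu_2^*$ be optimal dual variables, that is,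 either (a) $\mu_1^*,\mu_2^*\ge0$ and $R^*=R^*(\mu_1^*,\mu_2^*)$ satisfy $$\mu_1^*(\operatorname{tr}R^*-P_T)=0,\quad \mu_2^*(\operatorname{tr}(W_2R^*)-P_I)=0,\quad \operatorname{tr}R^*\le P_T,\quad \operatorname{tr}(W_2R^*)\le P_I,$$ or (b) $\mu_1^*,\mu_2^*$ are Lagrange multipliers of the two power constraints in the KKT system of the problem, i.e. there are $R\ge0$ and $M\ge0$ with $-(I+W_1R)^{-1}W_1-M+\mu_1^*I+\mu_2^*W_2=0$, $MR=0$, $\mu_1^*,\mu_2^*\ge0$, and the four relations in (a) with $R$ in place of $R^*$. Then $$0\le \mu_1^*\le m\,\bigl(P_T+\lambda_1(W_1)^{-1}\bigr)^{-1},\qquad 0\le\mu_2^* ,$$ and, if $P_I>0$, $$\mu_2^*\le\Bigl(\frac{P_I}{r_2}+\frac{\lambda_m(W_2)}{\lambda_1(W_1)}\Bigr)^{-1},$$ where $\lambda_1$ and $\lambda_m$ denote the largest and the smallest eigenvalue and $r_2=\operatorname{rank}W_2$ (if $W_2=0$ the last right-hand side is read as $0$). -/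

import Mathlib

open scoped ComplexOrder

noncomputable section

namespace MIMO

variable {m : ℕ}

/-- Largest eigenvalue `λ₁(W)` of a Hermitian matrix. -/
def lamMax {W : Matrix (Fin m) (Fin m) ℂ} (hW : W.IsHermitian) : ℝ :=
  ⨆ i, hW.eigenvalues i

/-- Smallest eigenvalue `λₘ(W)` of a Hermitian matrix. -/
def lamMin {W : Matrix (Fin m) (Fin m) ℂ} (hW : W.IsHermitian) : ℝ :=
  ⨅ i, hW.eigenvalues i

/-- Moore–Penrose pseudo-inverse of a Hermitian matrix: every nonzero eigenvalue is inverted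
and the eigenvalue `0` is kept (in Lean `(0 : ℝ)⁻¹ = 0`). -/
def pinv (A : Matrix (Fin m) (Fin m) ℂ) : Matrix (Fin m) (Fin m) ℂ :=
  cfc (fun x : ℝ => x⁻¹) A

/-- Orthogonal projection onto the null space of a Hermitian matrix. -/
def kerProj (A : Matrix (Fin m) (Fin m) ℂ) : Matrix (Fin m) (Fin m) ℂ :=
  cfc (fun x : ℝ => if x = 0 then 1 else 0) A

/-- `(A)₊ = ∑_{i : λᵢ > 0} λᵢ uᵢ uᵢ⁺`, the positive eigenmodes of a Hermitian matrix. -/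
def posPart (A : Matrix (Fin m) (Fin m) ℂ) : Matrix (Fin m) (Fin m) ℂ :=
  cfc (fun x : ℝ => max x 0) A

/-- `W_μ = (μ₁ I + μ₂ W₂)^{1/2}`. -/
def Wmu (W₂ : Matrix (Fin m) (Fin m) ℂ) (μ₁ μ₂ : ℝ) : Matrix (Fin m) (Fin m) ℂ :=
  cfc Real.sqrt ((μ₁ : ℂ) • (1 : Matrix (Fin m) (Fin m) ℂ) + (μ₂ : ℂ) • W₂)

/-- Orthogonal projection onto `{x | W_μ x ∈ range W₁}`. With `P = kerProj W₁` the projection onto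
the complement of `range W₁`, this subspace is the null space of `W_μ P W_μ`.
It is the domain of the form `x ↦ x⁺ W_μ W₁⁻¹ W_μ x`, where `W₁⁻¹` is infinite off `range W₁`;
when `W₁` is invertible it is the whole space. -/
def domProj (W₁ W₂ : Matrix (Fin m) (Fin m) ℂ) (μ₁ μ₂ : ℝ) : Matrix (Fin m) (Fin m) ℂ :=
  kerProj (Wmu W₂ μ₁ μ₂ * kerProj W₁ * Wmu W₂ μ₁ μ₂)

/-- `R*(μ₁, μ₂) = W_μ† (I - W_μ W₁⁻¹ W_μ)₊ W_μ†`. For singular `W₁` the modes on which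
`W_μ W₁⁻¹ W_μ` is infinite are not positive modes of `I - W_μ W₁⁻¹ W_μ`, so they are projected
out before the positive part is taken. -/
def Rstar (W₁ W₂ : Matrix (Fin m) (Fin m) ℂ) (μ₁ μ₂ : ℝ) : Matrix (Fin m) (Fin m) ℂ :=
  pinv (Wmu W₂ μ₁ μ₂) *
    posPart (domProj W₁ W₂ μ₁ μ₂ * (1 - Wmu W₂ μ₁ μ₂ * pinv W₁ * Wmu W₂ μ₁ μ₂) *
      domProj W₁ W₂ μ₁ μ₂) *
    pinv (Wmu W₂ μ₁ μ₂)

/-- `(μ₁, μ₂)` solves the dual equations: nonnegativity, complementary slackness for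
`R*(μ₁, μ₂)`, and the two power constraints for `R*(μ₁, μ₂)`. -/
structure SolvesDualEquations (W₁ W₂ : Matrix (Fin m) (Fin m) ℂ) (P_T P_I μ₁ μ₂ : ℝ) : Prop where
  nonneg₁ : 0 ≤ μ₁
  nonneg₂ : 0 ≤ μ₂
  slack₁ : μ₁ * ((Rstar W₁ W₂ μ₁ μ₂).trace.re - P_T) = 0
  slack₂ : μ₂ * ((W₂ * Rstar W₁ W₂ μ₁ μ₂).trace.re - P_I) = 0
  power : (Rstar W₁ W₂ μ₁ μ₂).trace.re ≤ P_T
  interference : (W₂ * Rstar W₁ W₂ μ₁ μ₂).trace.re ≤ P_I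

/-- The Karush–Kuhn–Tucker system of
`max log|I + W₁R|` subject to `R ≥ 0`, `tr R ≤ P_T`, `tr (W₂R) ≤ P_I`;
`M` is the multiplier of the constraint `R ≥ 0`. -/
structure IsKKT (W₁ W₂ : Matrix (Fin m) (Fin m) ℂ) (P_T P_I : ℝ)
    (R M : Matrix (Fin m) (Fin m) ℂ) (μ₁ μ₂ : ℝ) : Prop where
  stationary : -((1 + W₁ * R)⁻¹ * W₁) - M +
    (μ₁ : ℂ) • (1 : Matrix (Fin m) (Fin m) ℂ) + (μ₂ : ℂ) • W₂ = 0
  slackM : M * R = 0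
  slack₁ : μ₁ * (R.trace.re - P_T) = 0
  slack₂ : μ₂ * ((W₂ * R).trace.re - P_I) = 0
  posM : M.PosSemidef
  nonneg₁ : 0 ≤ μ₁
  nonneg₂ : 0 ≤ μ₂
  power : R.trace.re ≤ P_T
  interference : (W₂ * R).trace.re ≤ P_I
  posR : R.PosSemidef

/-- `(μ₁, μ₂)` is a pair of Lagrange multipliers for the two power constraints. -/
def IsLagrangeMultiplier (W₁ W₂ : Matrix (Fin m) (Fin m) ℂ) (P_T P_I μ₁ μ₂ : ℝ) : Prop :=
  ∃ R M : Matrix (Fin m) (Fin m) ℂ, IsKKT W₁ W₂ P_T P_I R M μ₁ μ₂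

end MIMO

end

open scoped MatrixOrder
open Matrix

namespace MIMO

variable {m : ℕ}

/-! Put `A = μ₁ I + μ₂ W₂` and `l = λ₁(W₁)`. Both kinds of dual variables come with a covariance `R
= Sᴴ S` which, when nonzero, satisfies `S A Sᴴ ≤ (1 - α/l) I` whenever `0 ≤ α` and `α I ≤ A`
(`IsBoundedCovariance`): see `IsKKT.isBoundedCovariance` and `Rstar_isBoundedCovariance`. Since `A`
dominates both `μ₁ I` and `μ₂ W₂`, taking traces with `α = μ₁` gives `μ₁ tr R ≤ m (1 - μ₁/l)`. With
`α = μ₂ λₘ(W₂)` the matrix `S (μ₂ W₂) Sᴴ` has rank at most `r₂`, so `μ₂ tr (W₂ R) ≤ r₂ (1 - μ₂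
λₘ(W₂)/l)`. If a multiplier is positive, slackness replaces the trace by the power limit, and
solving for the multiplier gives the bound. -/

/-! ### Quadratic forms, extreme eigenvalues and trace bounds. -/

/-- The real quadratic form `u ↦ u⁺ N u`. -/
def quadForm (N : Matrix (Fin m) (Fin m) ℂ) (u : Fin m → ℂ) : ℝ :=
  (star u ⬝ᵥ (N *ᵥ u)).re

lemma quadForm_sub (M N : Matrix (Fin m) (Fin m) ℂ) (u : Fin m → ℂ) :
    quadForm (M - N) u = quadForm M u - quadForm N u := by
  simp [quadForm, sub_mulVec, dotProduct_sub]

lemma quadForm_smul (c : ℝ) (N : Matrix (Fin m) (Fin m) ℂ) (u : Fin m → ℂ) :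
    quadForm (c • N) u = c * quadForm N u := by
  simp [quadForm, smul_mulVec, dotProduct_smul]

lemma quadForm_conj (S N : Matrix (Fin m) (Fin m) ℂ) (u : Fin m → ℂ) :
    quadForm (S * N * Sᴴ) u = quadForm N (Sᴴ *ᵥ u) := by
  simp [quadForm, ← mulVec_mulVec, star_mulVec, dotProduct_mulVec]

lemma quadForm_nonneg {N : Matrix (Fin m) (Fin m) ℂ} (hN : N.PosSemidef) (u : Fin m → ℂ) :
    0 ≤ quadForm N u :=
  (Complex.le_def.1 (hN.dotProduct_mulVec_nonneg u)).1

lemma quadForm_mono {M N : Matrix (Fin m) (Fin m) ℂ} (h : M ≤ N) (u : Fin m → ℂ) :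
    quadForm M u ≤ quadForm N u := by
  have := quadForm_nonneg (Matrix.le_iff.1 h) u
  rw [quadForm_sub] at this
  linarith

lemma quadForm_of_eigenvector {N : Matrix (Fin m) (Fin m) ℂ} {u : Fin m → ℂ} {c : ℝ}
    (hu : N *ᵥ u = c • u) : quadForm N u = c * quadForm 1 u := by
  simp [quadForm, hu]

lemma exists_eigenvector {N : Matrix (Fin m) (Fin m) ℂ} (hN : N.IsHermitian) {c : ℝ}
    (hc : c ∈ spectrum ℝ N) :
    ∃ u : Fin m → ℂ, N *ᵥ u = c • u ∧ quadForm 1 u = 1 := by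
  obtain ⟨i, rfl⟩ := hN.spectrum_real_eq_range_eigenvalues ▸ hc
  refine ⟨_, hN.mulVec_eigenvectorBasis i, ?_⟩
  have h1 := hN.eigenvectorBasis.orthonormal.1 i
  have h2 : inner ℂ (hN.eigenvectorBasis i) (hN.eigenvectorBasis i) = (1 : ℂ) := by
    rw [inner_self_eq_norm_sq_to_K, h1]; simp
  rw [EuclideanSpace.inner_eq_star_dotProduct, dotProduct_comm] at h2
  simp [quadForm, h2]

lemma le_smul_one {N : Matrix (Fin m) (Fin m) ℂ} (hN : N.IsHermitian) {c : ℝ}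
    (h : ∀ x ∈ spectrum ℝ N, x ≤ c) : N ≤ c • 1 := by
  rw [← Algebra.algebraMap_eq_smul_one]
  exact le_algebraMap_of_spectrum_le h hN.isSelfAdjoint

lemma smul_one_le {N : Matrix (Fin m) (Fin m) ℂ} (hN : N.IsHermitian) {c : ℝ}
    (h : ∀ x ∈ spectrum ℝ N, c ≤ x) : c • 1 ≤ N := by
  rw [← Algebra.algebraMap_eq_smul_one]
  exact algebraMap_le_of_le_spectrum h hN.isSelfAdjoint

lemma le_lamMax {W : Matrix (Fin m) (Fin m) ℂ} (hW : W.IsHermitian) {x : ℝ}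
    (hx : x ∈ spectrum ℝ W) : x ≤ lamMax hW := by
  obtain ⟨i, rfl⟩ := hW.spectrum_real_eq_range_eigenvalues ▸ hx
  exact le_ciSup (Set.finite_range _).bddAbove i

lemma lamMin_le {W : Matrix (Fin m) (Fin m) ℂ} (hW : W.IsHermitian) {x : ℝ}
    (hx : x ∈ spectrum ℝ W) : lamMin hW ≤ x := by
  obtain ⟨i, rfl⟩ := hW.spectrum_real_eq_range_eigenvalues ▸ hx
  exact ciInf_le (Set.finite_range _).bddBelow i

lemma lamMin_nonneg {W : Matrix (Fin m) (Fin m) ℂ} (hW : W.PosSemidef) :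
    0 ≤ lamMin hW.isHermitian :=
  Real.iInf_nonneg hW.eigenvalues_nonneg

lemma lamMax_pos {W : Matrix (Fin m) (Fin m) ℂ} (hW : W.PosSemidef) (h0 : W ≠ 0) :
    0 < lamMax hW.isHermitian := by
  by_contra! h
  refine h0 (le_antisymm ?_ hW.nonneg)
  have := le_smul_one (c := 0) hW.isHermitian fun x hx => (le_lamMax hW.isHermitian hx).trans h
  simpa using this

/-- A positive semidefinite matrix bounded by `κ I` has trace at most `κ` times its rank. -/
lemma re_trace_le_rank_mul {N : Matrix (Fin m) (Fin m) ℂ} (hN : N.PosSemidef) {κ : ℝ}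
    (h : N ≤ κ • 1) : N.trace.re ≤ N.rank * κ := by
  have hH := hN.isHermitian
  have hle : ∀ i, hH.eigenvalues i ≤ κ := fun i => by
    have hmem : hH.eigenvalues i ∈ spectrum ℝ N := by
      rw [hH.spectrum_real_eq_range_eigenvalues]; exact ⟨i, rfl⟩
    obtain ⟨u, hu, hu1⟩ := exists_eigenvector hH hmem
    have := quadForm_mono h u
    rwa [quadForm_of_eigenvector hu, quadForm_smul, hu1, mul_one, mul_one] at this
  rw [hH.rank_eq_card_non_zero_eigs, hH.trace_eq_sum_eigenvalues, Fintype.card_subtype]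
  simp only [Complex.re_sum, Complex.coe_algebraMap, Complex.ofReal_re]
  calc ∑ i, hH.eigenvalues i
      = ∑ i with hH.eigenvalues i ≠ 0, hH.eigenvalues i := (Finset.sum_filter_ne_zero _).symm
    _ ≤ ∑ i with hH.eigenvalues i ≠ 0, κ := Finset.sum_le_sum fun i _ => hle i
    _ = _ := by simp

lemma re_trace_le_mul {N : Matrix (Fin m) (Fin m) ℂ} {κ : ℝ} (h : N ≤ κ • 1) :
    N.trace.re ≤ m * κ := by
  have := (Complex.le_def.1 (Matrix.le_iff.1 h).trace_nonneg).1
  simp [trace_sub, trace_smul] at this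
  linarith

/-! ### The dual matrix and the trace bounds for a bounded covariance. -/

/-- The dual matrix `μ₁ I + μ₂ W₂`. -/
def dualMat (W₂ : Matrix (Fin m) (Fin m) ℂ) (μ₁ μ₂ : ℝ) : Matrix (Fin m) (Fin m) ℂ :=
  (μ₁ : ℂ) • (1 : Matrix (Fin m) (Fin m) ℂ) + (μ₂ : ℂ) • W₂

lemma dualMat_eq (W₂ : Matrix (Fin m) (Fin m) ℂ) (μ₁ μ₂ : ℝ) :
    dualMat W₂ μ₁ μ₂ = μ₁ • (1 : Matrix (Fin m) (Fin m) ℂ) + μ₂ • W₂ := rfl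

lemma smul_one_le_dualMat {W₂ : Matrix (Fin m) (Fin m) ℂ} (hW₂ : W₂.PosSemidef) (μ₁ : ℝ) {μ₂ : ℝ}
    (h₂ : 0 ≤ μ₂) : μ₁ • (1 : Matrix (Fin m) (Fin m) ℂ) ≤ dualMat W₂ μ₁ μ₂ := by
  rw [dualMat_eq]
  exact le_add_of_nonneg_right (smul_nonneg h₂ hW₂.nonneg)

lemma smul_le_dualMat (W₂ : Matrix (Fin m) (Fin m) ℂ) {μ₁ : ℝ} (h₁ : 0 ≤ μ₁) (μ₂ : ℝ) :
    μ₂ • W₂ ≤ dualMat W₂ μ₁ μ₂ := by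
  rw [dualMat_eq]
  exact le_add_of_nonneg_left (smul_nonneg h₁ zero_le_one)

lemma dualMat_posSemidef {W₂ : Matrix (Fin m) (Fin m) ℂ} (hW₂ : W₂.PosSemidef) {μ₁ μ₂ : ℝ}
    (h₁ : 0 ≤ μ₁) (h₂ : 0 ≤ μ₂) : (dualMat W₂ μ₁ μ₂).PosSemidef :=
  Matrix.nonneg_iff_posSemidef.1 ((smul_nonneg h₁ zero_le_one).trans (smul_one_le_dualMat hW₂ μ₁ h₂))

/-- `R = S⁺S` with `S (μ₁ I + μ₂ W₂) S⁺ ≤ (1 - α / l) I` for every `α ≥ 0` with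
`α I ≤ μ₁ I + μ₂ W₂`. -/
def IsBoundedCovariance (W₂ : Matrix (Fin m) (Fin m) ℂ) (l μ₁ μ₂ : ℝ)
    (R : Matrix (Fin m) (Fin m) ℂ) : Prop :=
  ∃ S : Matrix (Fin m) (Fin m) ℂ, R = Sᴴ * S ∧ ∀ α : ℝ, 0 ≤ α →
    α • (1 : Matrix (Fin m) (Fin m) ℂ) ≤ dualMat W₂ μ₁ μ₂ →
      S * dualMat W₂ μ₁ μ₂ * Sᴴ ≤ (1 - α / l) • (1 : Matrix (Fin m) (Fin m) ℂ)

lemma conj_mono {M N : Matrix (Fin m) (Fin m) ℂ} (h : M ≤ N) (S : Matrix (Fin m) (Fin m) ℂ) :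
    S * M * Sᴴ ≤ S * N * Sᴴ :=
  star_right_conjugate_le_conjugate h S

lemma IsBoundedCovariance.mul_trace_le {W₂ R : Matrix (Fin m) (Fin m) ℂ} {l μ₁ μ₂ : ℝ}
    (hW₂ : W₂.PosSemidef) (h₁ : 0 ≤ μ₁) (h₂ : 0 ≤ μ₂) (hR : IsBoundedCovariance W₂ l μ₁ μ₂ R) :
    μ₁ * R.trace.re ≤ m * (1 - μ₁ / l) := by
  obtain ⟨S, rfl, hS⟩ := hR
  have hA := smul_one_le_dualMat hW₂ μ₁ h₂
  have := re_trace_le_mul ((conj_mono hA S).trans (hS μ₁ h₁ hA))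
  simpa [trace_smul, trace_mul_comm S] using this

lemma IsBoundedCovariance.mul_trace_mul_le {W₂ R : Matrix (Fin m) (Fin m) ℂ} {l μ₁ μ₂ : ℝ}
    (hW₂ : W₂.PosSemidef) (h₁ : 0 ≤ μ₁) (h₂ : 0 ≤ μ₂)
    (hR : IsBoundedCovariance W₂ l μ₁ μ₂ R) (hR0 : R ≠ 0) :
    μ₂ * (W₂ * R).trace.re ≤ W₂.rank * (1 - μ₂ * lamMin hW₂.isHermitian / l) := by
  obtain ⟨S, rfl, hS⟩ := hR
  set a := lamMin hW₂.isHermitian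
  have hle : (μ₂ * a) • (1 : Matrix (Fin m) (Fin m) ℂ) ≤ dualMat W₂ μ₁ μ₂ := by
    rw [mul_smul]
    exact (smul_le_smul_of_nonneg_left
      (smul_one_le hW₂.isHermitian fun x hx => lamMin_le _ hx) h₂).trans (smul_le_dualMat W₂ h₁ μ₂)
  have hN := (conj_mono (smul_le_dualMat W₂ h₁ μ₂) S).trans
    (hS _ (mul_nonneg h₂ (lamMin_nonneg hW₂)) hle)
  have hpos : (S * (μ₂ • W₂) * Sᴴ).PosSemidef :=
    (Matrix.nonneg_iff_posSemidef.1 (smul_nonneg h₂ hW₂.nonneg)).mul_mul_conjTranspose_same S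
  -- Nonnegativity is what allows the rank to be enlarged to `W₂.rank` at the end; it needs a
  -- diagonal entry, hence `m ≠ 0`.
  have hκ : 0 ≤ 1 - μ₂ * a / l := by
    obtain ⟨i, -⟩ : ∃ i : Fin m, True := by
      by_contra! h
      exact hR0 (Matrix.ext fun i => (h i).elim)
    have := quadForm_mono (hpos.nonneg.trans hN) (Pi.single i 1)
    rw [quadForm_smul] at this
    simpa [quadForm] using this
  have htr := re_trace_le_rank_mul hpos hN
  have hrank : (S * (μ₂ • W₂) * Sᴴ).rank ≤ W₂.rank := by
    have : S * (μ₂ • W₂) * Sᴴ = S * W₂ * (μ₂ • Sᴴ) := by simp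
    rw [this]
    exact (rank_mul_le_left _ _).trans (rank_mul_le_right _ _)
  have heq : (S * (μ₂ • W₂) * Sᴴ).trace.re = μ₂ * (W₂ * (Sᴴ * S)).trace.re := by
    rw [mul_assoc, trace_mul_comm]
    simp [trace_smul, mul_assoc]
  rw [heq] at htr
  exact htr.trans (mul_le_mul_of_nonneg_right (by exact_mod_cast hrank) hκ)

/-! ### Covariances from the KKT system. -/

/-- Let `C = S A Sᴴ`, `B = S W Sᴴ`, so `C + B C = B`. On a unit eigenvector `u` of `C` with
eigenvalue `c`, set `b = uᴴ B u` and `x = ‖Sᴴ u‖²`. Then `c = b (1 - c)`, `b ≤ l x` and `α x ≤ c`,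
so `α x ≤ l x (1 - c)`; cancel `x`. -/
lemma conj_le_of_sylvester {S A W : Matrix (Fin m) (Fin m) ℂ} {l α : ℝ} (hl : 0 < l) (hα : 0 ≤ α)
    (hS : S ≠ 0) (hA : A.PosSemidef) (hW : W.PosSemidef) (hWl : W ≤ l • 1) (hαA : α • 1 ≤ A)
    (h : S * A * Sᴴ + S * W * Sᴴ * (S * A * Sᴴ) = S * W * Sᴴ) :
    S * A * Sᴴ ≤ (1 - α / l) • 1 := by
  have hC := hA.mul_mul_conjTranspose_same S
  have hB := hW.mul_mul_conjTranspose_same S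
  have key : ∀ c ∈ spectrum ℝ (S * A * Sᴴ), c ≤ 1 ∧ (0 < c → c ≤ 1 - α / l) := by
    intro c hc
    obtain ⟨u, hu, hu1⟩ := exists_eigenvector hC.isHermitian hc
    have hqC := quadForm_of_eigenvector hu
    have hqB := quadForm_nonneg hB u
    have hrel : c + quadForm (S * W * Sᴴ) u * c = quadForm (S * W * Sᴴ) u := by
      rw [hu1, mul_one] at hqC
      nth_rewrite 1 [← hqC]
      nth_rewrite 2 [← h]
      simp only [quadForm, add_mulVec, dotProduct_add, Complex.add_re]
      rw [← mulVec_mulVec (M := S * W * Sᴴ), hu]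
      simp only [mulVec_smul, dotProduct_smul, Complex.real_smul, Complex.re_ofReal_mul]
      ring
    have h1 : l * quadForm 1 (Sᴴ *ᵥ u) ≥ quadForm (S * W * Sᴴ) u := by
      rw [quadForm_conj, ← quadForm_smul]
      exact quadForm_mono hWl _
    have h2 : α * quadForm 1 (Sᴴ *ᵥ u) ≤ c := by
      rw [hu1, mul_one] at hqC
      rw [← hqC, quadForm_conj, ← quadForm_smul]
      exact quadForm_mono hαA _
    have hx := quadForm_nonneg (PosSemidef.one) (Sᴴ *ᵥ u)
    set b := quadForm (S * W * Sᴴ) u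
    set x := quadForm 1 (Sᴴ *ᵥ u)
    have hc1 : c ≤ 1 := by
      by_contra! hcon
      nlinarith
    refine ⟨hc1, fun hc0 => ?_⟩
    rw [le_sub_iff_add_le, ← le_sub_iff_add_le', div_le_iff₀ hl]
    -- If `x = 0` then `b = 0`, which forces `c = 0`.
    have hx0 : 0 < x := by
      by_contra! hcon
      nlinarith
    refine le_of_mul_le_mul_right ?_ hx0
    nlinarith [mul_le_mul_of_nonneg_left h1 (sub_nonneg.2 hc1)]
  refine le_smul_one hC.isHermitian fun c hc => ?_
  rcases lt_or_ge 0 c with hc0 | hc0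
  · exact (key c hc).2 hc0
  -- For a null mode it remains to see `α ≤ l`; this follows from any positive mode, and one exists
  -- because `S ≠ 0`.
  refine hc0.trans ?_
  rcases hα.eq_or_lt with rfl | hα'
  · simp
  have hne : S * A * Sᴴ ≠ 0 := by
    intro h0
    have h1 := conj_mono hαA S
    have h2 : α • (S * Sᴴ) ≤ 0 := by simpa [h0] using h1
    have h3 : α • (S * Sᴴ) = 0 :=
      le_antisymm h2 (smul_nonneg hα (posSemidef_self_mul_conjTranspose S).nonneg)
    rw [smul_eq_zero_iff_right hα'.ne', self_mul_conjTranspose_eq_zero] at h3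
    exact hS h3
  obtain ⟨d, hd, hd0⟩ : ∃ d ∈ spectrum ℝ (S * A * Sᴴ), 0 < d := by
    by_contra! hcon
    refine hne (le_antisymm ?_ hC.nonneg)
    simpa using le_smul_one hC.isHermitian hcon
  exact hd0.le.trans ((key d hd).2 hd0)

/-- `M R = 0` gives `M Sᴴ = 0`, so conjugation by `S` removes `M` from the stationarity equation;
what is left is the relation required by `conj_le_of_sylvester`. -/
lemma IsKKT.isBoundedCovariance {W₁ W₂ R M : Matrix (Fin m) (Fin m) ℂ} {P_T P_I μ₁ μ₂ : ℝ}
    (hW₁ : W₁.PosSemidef) (hW₂ : W₂.PosSemidef) (h0 : W₁ ≠ 0)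
    (h : IsKKT W₁ W₂ P_T P_I R M μ₁ μ₂) (hR : R ≠ 0) :
    IsBoundedCovariance W₂ (lamMax hW₁.isHermitian) μ₁ μ₂ R := by
  obtain ⟨S, rfl⟩ := CStarAlgebra.nonneg_iff_eq_star_mul_self.1 h.posR.nonneg
  rw [star_eq_conjTranspose] at *
  refine ⟨S, rfl, fun α hα hαA => ?_⟩
  have hS : S ≠ 0 := by
    rintro rfl
    exact hR (by simp)
  refine conj_le_of_sylvester (lamMax_pos hW₁ h0) hα hS
    (dualMat_posSemidef hW₂ h.nonneg₁ h.nonneg₂) hW₁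
    (le_smul_one hW₁.isHermitian fun x hx => le_lamMax _ hx) hαA ?_
  -- By Sylvester's determinant identity this is the determinant of the positive definite `1 + S W₁
  -- Sᴴ`.
  have hunit : IsUnit (1 + W₁ * (Sᴴ * S)).det := by
    rw [← mul_assoc, det_one_add_mul_comm, ← mul_assoc, ← isUnit_iff_isUnit_det]
    exact (PosDef.one.add_posSemidef (hW₁.mul_mul_conjTranspose_same S)).isUnit
  have hMS : M * Sᴴ = 0 := by
    have h1 : (S * M)ᴴ * (S * M) = 0 := by
      rw [conjTranspose_mul, h.posM.isHermitian.eq, mul_assoc, ← mul_assoc Sᴴ, ← mul_assoc M,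
        h.slackM, zero_mul]
    have h2 := congrArg conjTranspose (conjTranspose_mul_self_eq_zero.1 h1)
    simpa [h.posM.isHermitian.eq] using h2
  set G := (1 + W₁ * (Sᴴ * S))⁻¹ * W₁ with hGdef
  have hG : G + W₁ * (Sᴴ * S) * G = W₁ := by
    rw [hGdef, ← Matrix.mul_assoc (W₁ * (Sᴴ * S))]
    nth_rewrite 1 [← Matrix.one_mul ((1 + W₁ * (Sᴴ * S))⁻¹)]
    rw [← add_mul, ← add_mul, mul_nonsing_inv _ hunit, one_mul]
  have hA : dualMat W₂ μ₁ μ₂ = G + M := by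
    have := h.stationary
    rw [add_assoc] at this
    rw [dualMat, ← sub_eq_zero, ← this]
    abel
  have hAS : S * dualMat W₂ μ₁ μ₂ * Sᴴ = S * G * Sᴴ := by
    rw [hA, mul_add, add_mul, mul_assoc S M, hMS, mul_zero, add_zero]
  rw [hAS]
  calc _ = S * (G + W₁ * (Sᴴ * S) * G) * Sᴴ := by simp only [mul_add, add_mul, mul_assoc]
    _ = _ := by rw [hG]

/-! ### Covariances from the closed form `Rstar`. -/

lemma hermitian_cfc (f : ℝ → ℝ) (A : Matrix (Fin m) (Fin m) ℂ) : (cfc f A).IsHermitian :=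
  IsSelfAdjoint.cfc

lemma continuousOn_spectrum (f : ℝ → ℝ) (A : Matrix (Fin m) (Fin m) ℂ) :
    ContinuousOn f (spectrum ℝ A) :=
  (Matrix.finite_real_spectrum (A := A)).continuousOn f

lemma Wmu_mul_self {W₂ : Matrix (Fin m) (Fin m) ℂ} {μ₁ μ₂ : ℝ}
    (hA : (dualMat W₂ μ₁ μ₂).PosSemidef) :
    Wmu W₂ μ₁ μ₂ * Wmu W₂ μ₁ μ₂ = dualMat W₂ μ₁ μ₂ := by
  change cfc Real.sqrt (dualMat W₂ μ₁ μ₂) * cfc Real.sqrt (dualMat W₂ μ₁ μ₂) = _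
  rw [← cfc_mul _ _ _ (continuousOn_spectrum _ _) (continuousOn_spectrum _ _)]
  nth_rewrite 2 [← cfc_id ℝ (dualMat W₂ μ₁ μ₂) hA.isHermitian.isSelfAdjoint]
  exact cfc_congr fun x hx => Real.mul_self_sqrt (spectrum_nonneg_of_nonneg hA.nonneg hx)

lemma pinv_conj_le_one {W : Matrix (Fin m) (Fin m) ℂ} (hW : W.IsHermitian) :
    pinv W * (W * W) * pinv W ≤ 1 := by
  have hc := fun f => continuousOn_spectrum (m := m) f W
  have : pinv W * (W * W) * pinv W = cfc (fun x : ℝ => x⁻¹ * (x * x) * x⁻¹) W := by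
    rw [cfc_mul _ _ _ (hc _) (hc _), cfc_mul _ _ _ (hc _) (hc _), cfc_mul _ _ _ (hc _) (hc _),
      cfc_id' ℝ W hW.isSelfAdjoint]
    rfl
  rw [this]
  refine cfc_le_one _ _ fun x _ => ?_
  rcases eq_or_ne x 0 with rfl | hx
  · simp
  · exact le_of_eq (by field_simp)

lemma kerProj_mul_self (A : Matrix (Fin m) (Fin m) ℂ) : kerProj A * kerProj A = kerProj A := by
  rw [kerProj, ← cfc_mul _ _ _ (continuousOn_spectrum _ _) (continuousOn_spectrum _ _)]
  congr 1
  ext x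
  simp

lemma mul_kerProj {A : Matrix (Fin m) (Fin m) ℂ} (hA : A.IsHermitian) : A * kerProj A = 0 := by
  nth_rewrite 1 [← cfc_id' ℝ A hA.isSelfAdjoint]
  rw [kerProj, ← cfc_mul _ _ _ (continuousOn_spectrum _ _) (continuousOn_spectrum _ _)]
  convert cfc_const_zero ℝ A using 2
  ext x
  simp

/-- On the range of `W`, the pseudo-inverse of `W ≤ l I` is at least `l⁻¹ I`. -/
lemma smul_one_le_pinv_add {W : Matrix (Fin m) (Fin m) ℂ} (hW : W.PosSemidef) {l : ℝ}
    (hl : ∀ x ∈ spectrum ℝ W, x ≤ l) :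
    l⁻¹ • 1 ≤ pinv W + l⁻¹ • kerProj W := by
  have hc := fun f => continuousOn_spectrum (m := m) f W
  have : pinv W + l⁻¹ • kerProj W =
      cfc (fun x : ℝ => x⁻¹ + l⁻¹ • if x = 0 then (1 : ℝ) else 0) W := by
    rw [cfc_add _ _ _ (hc _) (hc _), cfc_smul _ _ _ (hc _)]
    rfl
  rw [this, ← Algebra.algebraMap_eq_smul_one]
  refine algebraMap_le_cfc _ _ _ (fun x hx => ?_) (hc _) hW.isHermitian.isSelfAdjoint
  have hx0 : 0 ≤ x := spectrum_nonneg_of_nonneg hW.nonneg hx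
  rcases hx0.eq_or_lt with rfl | hx0
  · simp
  · simpa [hx0.ne'] using inv_anti₀ hx0 (hl x hx)

/-- Take `S = Y₊^{1/2} W_μ†`: as `W_μ† W_μ² W_μ† ≤ 1`, `S A Sᴴ ≤ Y₊`. A positive mode `u` of `Y`
lies in the range of the projection, so `v = W_μ u` lies in the range of `W₁` and its eigenvalue is
`1 - vᴴ W₁† v ≤ 1 - ‖v‖²/l = 1 - uᴴ A u/l ≤ 1 - α/l`. -/
lemma Rstar_isBoundedCovariance {W₁ W₂ : Matrix (Fin m) (Fin m) ℂ} {μ₁ μ₂ : ℝ}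
    (hW₁ : W₁.PosSemidef) (hW₂ : W₂.PosSemidef) (h0 : W₁ ≠ 0) (h₁ : 0 ≤ μ₁) (h₂ : 0 ≤ μ₂)
    (hR : Rstar W₁ W₂ μ₁ μ₂ ≠ 0) :
    IsBoundedCovariance W₂ (lamMax hW₁.isHermitian) μ₁ μ₂ (Rstar W₁ W₂ μ₁ μ₂) := by
  have hl := lamMax_pos hW₁ h0
  set l := lamMax hW₁.isHermitian with hl_def
  have hAW := Wmu_mul_self (dualMat_posSemidef hW₂ h₁ h₂)
  have hWH : (Wmu W₂ μ₁ μ₂).IsHermitian := hermitian_cfc _ _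
  have hDH : (domProj W₁ W₂ μ₁ μ₂).IsHermitian := hermitian_cfc _ _
  have hDD : domProj W₁ W₂ μ₁ μ₂ * domProj W₁ W₂ μ₁ μ₂ = domProj W₁ W₂ μ₁ μ₂ :=
    kerProj_mul_self _
  have hPH : (kerProj W₁).IsHermitian := hermitian_cfc _ _
  have hQH : (pinv W₁).IsHermitian := hermitian_cfc _ _
  have hPWD : kerProj W₁ * Wmu W₂ μ₁ μ₂ * domProj W₁ W₂ μ₁ μ₂ = 0 := by
    have hZH : (Wmu W₂ μ₁ μ₂ * kerProj W₁ * Wmu W₂ μ₁ μ₂).IsHermitian := by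
      simpa [hWH.eq] using isHermitian_mul_mul_conjTranspose (Wmu W₂ μ₁ μ₂) hPH
    have hZD : Wmu W₂ μ₁ μ₂ * kerProj W₁ * Wmu W₂ μ₁ μ₂ * domProj W₁ W₂ μ₁ μ₂ = 0 :=
      mul_kerProj hZH
    -- With `P = kerProj W₁` and `D = domProj W₁ W₂ μ₁ μ₂`, `(P W_μ D)ᴴ (P W_μ D) = D (W_μ P W_μ D)
    -- = 0`.
    refine conjTranspose_mul_self_eq_zero.1 ?_
    simp only [conjTranspose_mul, hWH.eq, hPH.eq, hDH.eq]
    calc _ = domProj W₁ W₂ μ₁ μ₂ * (Wmu W₂ μ₁ μ₂ * (kerProj W₁ * kerProj W₁) * Wmu W₂ μ₁ μ₂ *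
          domProj W₁ W₂ μ₁ μ₂) := by simp only [mul_assoc]
      _ = 0 := by rw [kerProj_mul_self, hZD, mul_zero]
  set Y := domProj W₁ W₂ μ₁ μ₂ * (1 - Wmu W₂ μ₁ μ₂ * pinv W₁ * Wmu W₂ μ₁ μ₂) *
    domProj W₁ W₂ μ₁ μ₂ with hY
  have hYH : Y.IsHermitian := by
    have h1 : (1 - Wmu W₂ μ₁ μ₂ * pinv W₁ * Wmu W₂ μ₁ μ₂).IsHermitian := by
      refine isHermitian_one.sub ?_
      simpa [hWH.eq] using isHermitian_mul_mul_conjTranspose (Wmu W₂ μ₁ μ₂) hQH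
    simpa [hDH.eq] using isHermitian_mul_mul_conjTranspose (domProj W₁ W₂ μ₁ μ₂) h1
  have hRY : Rstar W₁ W₂ μ₁ μ₂ = pinv (Wmu W₂ μ₁ μ₂) * posPart Y * pinv (Wmu W₂ μ₁ μ₂) := rfl
  have hmode : ∀ α : ℝ, α • 1 ≤ dualMat W₂ μ₁ μ₂ → ∀ y ∈ spectrum ℝ Y, 0 < y →
      y ≤ 1 - α / l := by
    intro α hα y hy hy0
    obtain ⟨u, hu, hu1⟩ := exists_eigenvector hYH hy
    have hDu : domProj W₁ W₂ μ₁ μ₂ *ᵥ u = u := by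
      have h1 : domProj W₁ W₂ μ₁ μ₂ *ᵥ (Y *ᵥ u) = Y *ᵥ u := by
        rw [mulVec_mulVec, hY, ← mul_assoc, ← mul_assoc, hDD]
      rw [hu, mulVec_smul] at h1
      exact smul_right_injective _ hy0.ne' h1
    have hPv : kerProj W₁ *ᵥ (Wmu W₂ μ₁ μ₂ *ᵥ u) = 0 := by
      rw [← hDu, mulVec_mulVec, mulVec_mulVec, hPWD, zero_mulVec]
    have hq : quadForm Y u = 1 - quadForm (pinv W₁) (Wmu W₂ μ₁ μ₂ *ᵥ u) := by
      have h1 := quadForm_conj (domProj W₁ W₂ μ₁ μ₂)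
        (1 - Wmu W₂ μ₁ μ₂ * pinv W₁ * Wmu W₂ μ₁ μ₂) u
      have h2 := quadForm_conj (Wmu W₂ μ₁ μ₂) (pinv W₁) u
      rw [hDH.eq, hDu, quadForm_sub, hu1] at h1
      rw [hWH.eq] at h2
      rw [h2] at h1
      exact h1
    have hp := quadForm_mono
      (smul_one_le_pinv_add hW₁ fun x hx => le_lamMax hW₁.isHermitian hx) (Wmu W₂ μ₁ μ₂ *ᵥ u)
    have hker : quadForm (pinv W₁ + l⁻¹ • kerProj W₁) (Wmu W₂ μ₁ μ₂ *ᵥ u) =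
        quadForm (pinv W₁) (Wmu W₂ μ₁ μ₂ *ᵥ u) := by
      simp only [quadForm, add_mulVec, smul_mulVec, hPv, smul_zero, add_zero]
    have hα' := quadForm_mono hα u
    have hWW := quadForm_conj (Wmu W₂ μ₁ μ₂) 1 u
    rw [hWH.eq, mul_one, hAW] at hWW
    rw [quadForm_smul, hu1, mul_one, hWW] at hα'
    rw [← hl_def, hker, quadForm_smul] at hp
    rw [quadForm_of_eigenvector hu, hu1, mul_one] at hq
    have := mul_le_mul_of_nonneg_left hα' (inv_pos.2 hl).le
    rw [div_eq_inv_mul]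
    linarith
  -- A positive mode shows `1 - α / l ≥ 0`, which covers the modes cut off by the positive part.
  obtain ⟨d, hd, hd0⟩ : ∃ d ∈ spectrum ℝ Y, 0 < d := by
    by_contra! hcon
    refine hR ?_
    have : posPart Y = 0 := by
      rw [← cfc_const_zero ℝ Y]
      exact cfc_congr fun x hx => max_eq_right (hcon x hx)
    rw [hRY, this, mul_zero, zero_mul]
  have hc := fun f => continuousOn_spectrum (m := m) f Y
  set F := cfc (fun x : ℝ => Real.sqrt (max x 0)) Y with hF
  have hFH : F.IsHermitian := hermitian_cfc _ _
  have hFF : F * F = posPart Y := by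
    rw [hF, ← cfc_mul _ _ _ (hc _) (hc _)]
    exact cfc_congr fun x _ => Real.mul_self_sqrt (le_max_right x 0)
  have hVH : (pinv (Wmu W₂ μ₁ μ₂)).IsHermitian := hermitian_cfc _ _
  refine ⟨F * pinv (Wmu W₂ μ₁ μ₂), ?_, fun α hα hαA => ?_⟩
  · rw [conjTranspose_mul, hFH.eq, hVH.eq, hRY, ← hFF]
    simp only [mul_assoc]
  · have hX : posPart Y ≤ (1 - α / l) • 1 := by
      rw [← Algebra.algebraMap_eq_smul_one]
      refine cfc_le_algebraMap _ _ _ (fun x hx => ?_) (hc _) hYH.isSelfAdjoint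
      rcases lt_or_ge 0 x with hx0 | hx0
      · rw [max_eq_left hx0.le]
        exact hmode α hαA x hx hx0
      · rw [max_eq_right hx0]
        exact hd0.le.trans (hmode α hαA d hd hd0)
    refine le_trans ?_ hX
    have := conj_mono (pinv_conj_le_one hWH) F
    rw [mul_one, hFH.eq, hFF, hAW] at this
    simpa only [conjTranspose_mul, hFH.eq, hVH.eq, mul_assoc] using this

end MIMO

/-! ### Slackness and the final bounds. -/

theorem mainTheorem11 (m : ℕ) (W₁ W₂ : Matrix (Fin m) (Fin m) ℂ)
    (hW₁ : W₁.PosSemidef) (hW₂ : W₂.PosSemidef) (hW₁0 : W₁ ≠ 0)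
    (P_T P_I : ℝ) (hP_T : 0 < P_T) (hP_I : 0 ≤ P_I) (μ₁ μ₂ : ℝ)
    (hμ : MIMO.SolvesDualEquations W₁ W₂ P_T P_I μ₁ μ₂ ∨
      MIMO.IsLagrangeMultiplier W₁ W₂ P_T P_I μ₁ μ₂) :
    (0 ≤ μ₁ ∧ μ₁ ≤ (m : ℝ) * (P_T + (MIMO.lamMax hW₁.isHermitian)⁻¹)⁻¹) ∧
    0 ≤ μ₂ ∧
    (0 < P_I → μ₂ ≤ (P_I / (W₂.rank : ℝ) +
      MIMO.lamMin hW₂.isHermitian / MIMO.lamMax hW₁.isHermitian)⁻¹) := by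
  have hl := MIMO.lamMax_pos hW₁ hW₁0
  have hmin := MIMO.lamMin_nonneg hW₂
  obtain ⟨R, h₁, h₂, hs₁, hs₂, hR⟩ : ∃ R : Matrix (Fin m) (Fin m) ℂ, 0 ≤ μ₁ ∧ 0 ≤ μ₂ ∧
      μ₁ * (R.trace.re - P_T) = 0 ∧ μ₂ * ((W₂ * R).trace.re - P_I) = 0 ∧
      (R ≠ 0 → MIMO.IsBoundedCovariance W₂ (MIMO.lamMax hW₁.isHermitian) μ₁ μ₂ R) := by
    rcases hμ with h | ⟨R, M, h⟩
    · exact ⟨_, h.nonneg₁, h.nonneg₂, h.slack₁, h.slack₂,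
        MIMO.Rstar_isBoundedCovariance hW₁ hW₂ hW₁0 h.nonneg₁ h.nonneg₂⟩
    · exact ⟨R, h.nonneg₁, h.nonneg₂, h.slack₁, h.slack₂, h.isBoundedCovariance hW₁ hW₂ hW₁0⟩
  have hm : 1 ≤ (m : ℝ) := by
    rcases Nat.eq_zero_or_pos m with rfl | h
    · exact absurd (Subsingleton.elim _ _) hW₁0
    · exact_mod_cast h
  set l := MIMO.lamMax hW₁.isHermitian
  refine ⟨⟨h₁, ?_⟩, h₂, fun hPI => ?_⟩
  · rcases h₁.eq_or_lt with rfl | hpos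
    · positivity
    have htr : R.trace.re = P_T := by
      simpa [hpos.ne', sub_eq_zero] using hs₁
    have hR0 : R ≠ 0 := by
      rintro rfl
      simp at htr
      linarith
    have hb := (hR hR0).mul_trace_le hW₂ h₁ h₂
    rw [htr] at hb
    rw [← div_eq_mul_inv, le_div_iff₀ (by positivity)]
    have hdiv : 0 ≤ μ₁ / l := by positivity
    rw [mul_add, ← div_eq_mul_inv]
    -- `m ≥ 1` weakens `m * (μ₁ / l)` to `μ₁ / l`.
    nlinarith
  · rcases h₂.eq_or_lt with rfl | hpos
    · positivity
    have htr : (W₂ * R).trace.re = P_I := by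
      simpa [hpos.ne', sub_eq_zero] using hs₂
    have hR0 : R ≠ 0 := by
      rintro rfl
      simp at htr
      linarith
    have hb := (hR hR0).mul_trace_mul_le hW₂ h₁ h₂ hR0
    rw [htr] at hb
    -- Rank zero would give `μ₂ * P_I ≤ 0`, against `μ₂ > 0` and `P_I > 0`.
    have hr : 0 < (W₂.rank : ℝ) := by
      refine lt_of_le_of_ne (Nat.cast_nonneg _) fun h => ?_
      rw [← h, zero_mul] at hb
      nlinarith
    rw [← one_div, le_div_iff₀ (by positivity), mul_add]
    rw [mul_comm (W₂.rank : ℝ), ← div_le_iff₀ hr] at hb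
    rw [← mul_div_assoc, ← mul_div_assoc]
    linarith
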